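/- Setting. Let $I\subset\mathbb R$ be a nonempty open interval. "Dirichlet conditions" means: the function tends to $0$ at both (finite or infinite) ends of $I$. An eigenstate of $-d^2/dx^2+V$ of energy $E$ is a nonzero $C^2$ solution of $-\psi''+V\psi=E\psi$ on $I$ satisfying the Dirichlet conditions; a formal eigenfunction is a nonzero $C^2$ solution, without boundary conditions; $f\sim g$ means $f=cg$ on $I$ for a constant $c\neq0$. The Darboux–Bäcklund transformation (DBT) with seed $\varphi$ is $V\mapsto V+2w_\varphi'$, $f\mapsto f'+w_\varphi f$, $\varphi\mapsto1/\varphi$, where $w_\varphi=-\varphi'/\varphi$. For a family $(\psi_\lambda)$ of formal eigenfunctions of $V$, the chain $(\nu_1,\dots,\nu_m)$ applies successively the DBTs whose seeds are $\psi_{\nu_1}$, then the image of $\psi_{\nu_2}$, and so on; $V^{(\nu_1,\dots,\nu_m)}$ and $\psi_\lambda^{(\nu_1,\dots,\nu_m)}$ are the final potential and the image of $\psi_\lambda$. Translationally shape invariant potential (TSIP) with $\Gamma_3$ symmetry. Let $U\subset\mathbb R^N$, $\varepsilon\in\mathbb R^N$, $\alpha_k=\alpha+k\varepsilon$ ($k\in\mathbb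 Z$), and let $V(x;\alpha)$, $\psi_0(x;\alpha)$ be smooth functions of $x\in I$ for $\alpha\in U\cup(-U)$, and $R(\alpha)\in\mathbb R$. Put $w_0=-\psi_0'/\psi_0$ and, for $n\ge0$, $$E_n(\alpha)=\sum_{k=0}^{n-1}R(\alpha_k),\qquad \psi_n(x;\alpha)=\widehat A^+(\alpha)\cdots\widehat A^+(\alpha_{n-1})\,\psi_0(x;\alpha_n),\qquad \widehat A^+(\alpha)=-\tfrac{d}{dx}+w_0(x;\alpha),$$ and, for $n\ge1$, $E_{-n}(\alpha)=-E_n(\alpha_{-n})$ and $\psi_{-n}(x;\alpha)=\psi_{n-1}(x;-\alpha)$. Assume: (i) for $\alpha\in U$, the complete list of eigenstates of $-d^2/dx^2+V(x;\alpha)$ (up to constant factors) is $(E_n(\alpha),\psi_n(\cdot;\alpha))$, with $E_0(\alpha)=0<E_1(\alpha)<\cdots$, where $n$ runs over the indices such that $\alpha_0,\dots,\alpha_n\in U$; (ii) $V(x;\alpha)+2w_0'(x;\alpha)=V(x;\alpha_1)+R(\alpha)$ (shape invariance) whenever $\alpha,\alpha_1\in U$ or $-\alpha,-\alpha_1\in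 U$, at all points where $\psi_0(x;\alpha)\ne0$; (iii) for $\alpha\in U$, $V(x;-\alpha)-V(x;\alpha)$ does not depend on $x$, and $\psi_0(x;-\alpha)$ is a formal eigenfunction of $V(x;-\alpha)$ of energy $0$; if moreover $\alpha_{-1}\in U$, then $|\psi_{-1}(x;\alpha)|\to\infty$ at both ends of $I$, so that $1/\psi_{-1}$ satisfies the Dirichlet conditions where it is defined (the DBT with seed $\psi_{-1}$ is state-adding). Lemma 4. Let $m\ge0$ and $\alpha_{-j}\in U$ for all $0\le j\le m$. Let $V^{(-M)}(x;\alpha)$ and $\psi_l^{(-M)}(x;\alpha)$ be obtained from $V(x;\alpha)$ and $\psi_l(x;\alpha)$ by the complete chain $-M=(-1,\dots,-m)$ of $m$ state-adding DBTs. Then: (a) for $1\le k\le m$, $\psi_{-k}(\cdot;\alpha)$ is a formal eigenfunction of $V(\cdot;\alpha)$ of energy $E_{-k}(\alpha)$; the seed of every step of the chain has no zero on $I$, and $V^{(-M)}$ is regular (smooth on $I$); (b) $V^{(-M)}(x;\alpha)=V(x;\alpha_{-m})+E_{-m}(\alpha)$ on $I$; (c) the complete list of eigenstates of $-d^2/dx^2+V^{(-M)}(x;\alpha)$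 with Dirichlet conditions is, in strictly increasing order of energy, $\bigl(E_{j-m}(\alpha),\psi^{(-M)}_{j-m}(\cdot;\alpha)\bigr)$, where $j\ge0$ is such that $j<m$ or $j-m$ is the index of an eigenstate of $V(x;\alpha)$: the chain adds exactly the $m$ levels $E_{-m}(\alpha)<\dots<E_{-1}(\alpha)<0$; (d) $\psi_{j-m}^{(-M)}(x;\alpha)\sim\psi_j(x;\alpha_{-m})$ on $I$ for all $j\ge0$; (e) the Wronskian $W(\psi_{-1},\dots,\psi_{-m}\mid x;\alpha)$ has no zero on $I$. -/

import Mathlib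

open scoped ContDiff

/-! ## Schroedinger equation, Dirichlet conditions, discrete spectrum on an open interval -/

/-- `f` tends to `0` at both ends of the open interval `I` (finite or infinite ends). -/
def VanishesAtEnds (I : Set ℝ) (f : ℝ → ℝ) : Prop :=
  ∀ η : ℝ, 0 < η → ∃ K : Set ℝ, K ⊆ I ∧ IsCompact K ∧ ∀ x ∈ I \ K, |f x| < η

/-- `|f|` tends to `+∞` at both ends of the open interval `I` (finite or infinite ends). -/
def DivergesAtEnds (I : Set ℝ) (f : ℝ → ℝ) : Prop :=
  ∀ C : ℝ, ∃ K : Set ℝ, K ⊆ I ∧ IsCompact K ∧ ∀ x ∈ I \ K, C < |f x|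

/-- `f` is a (formal) eigenfunction of `-d²/dx² + V` on `I` for the eigenvalue `E`: a classical
solution, not identically zero; no boundary condition is imposed. -/
structure IsFormalEigenfunction (I : Set ℝ) (V : ℝ → ℝ) (E : ℝ) (f : ℝ → ℝ) : Prop where
  contDiffOn : ContDiffOn ℝ 2 f I
  equation : ∀ x ∈ I, -deriv (deriv f) x + V x * f x = E * f x
  nontrivial : ∃ x ∈ I, f x ≠ 0

/-- `f` is an eigenstate (bound state): a formal eigenfunction which satisfies the Dirichlet
conditions at both ends of `I`. -/
structure IsEigenstate (I : Set ℝ) (V : ℝ → ℝ) (E : ℝ) (f : ℝ → ℝ) : Prop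
    extends IsFormalEigenfunction I V E f where
  dirichlet : VanishesAtEnds I f

/-- Equality on `I` up to a nonzero multiplicative constant, written `f ∼ g` in the literature. -/
def PropOn (I : Set ℝ) (f g : ℝ → ℝ) : Prop :=
  ∃ c : ℝ, c ≠ 0 ∧ ∀ x ∈ I, f x = c * g x

/-- `(e n, φ n)`, `n ∈ L`, is the whole bound state spectrum of `-d²/dx² + V` on `I` with
Dirichlet conditions: the levels are listed in strictly increasing order, `φ n` is an eigenstate
of energy `e n`, and every eigenstate is one of them up to a constant factor. -/
structure IsDirichletSpectrum (I : Set ℝ) (V : ℝ → ℝ) (L : Set ℕ) (e : ℕ → ℝ)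
    (φ : ℕ → ℝ → ℝ) : Prop where
  eigenstate : ∀ n ∈ L, IsEigenstate I V (e n) (φ n)
  increasing : StrictMonoOn e L
  complete : ∀ (E : ℝ) (f : ℝ → ℝ), IsEigenstate I V E f → ∃ n ∈ L, E = e n ∧ PropOn I f (φ n)

/-! ## Darboux-Baecklund transformations (DBT) and their chains -/

noncomputable section

/-- The Riccati-Schroedinger function `w = -ψ'/ψ`. -/
def rsFun (ψ : ℝ → ℝ) : ℝ → ℝ := fun x => -deriv ψ x / ψ x

/-- The first order operator `A(w_φ) = d/dx + w_φ`. -/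
def opA (φ f : ℝ → ℝ) : ℝ → ℝ := fun x => deriv f x + rsFun φ x * f x

/-- The first order operator `A⁺(w_φ) = -d/dx + w_φ`. -/
def opAdj (φ f : ℝ → ℝ) : ℝ → ℝ := fun x => -deriv f x + rsFun φ x * f x

/-- The potential `V + 2 w_φ'` obtained from `V` by the DBT with seed function `φ`. -/
def dbtPotential (V φ : ℝ → ℝ) : ℝ → ℝ := fun x => V x + 2 * deriv (rsFun φ) x

/-- The images of a family `ψ` of eigenfunctions by the DBT with seed `ψ ν`: the image of `ψ l` is
`A(w_ν) ψ l` for `l ≠ ν`, and the image of the seed is `1 / ψ ν`. -/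
def dbtFamily (ν : ℤ) (ψ : ℤ → ℝ → ℝ) : ℤ → ℝ → ℝ := fun l =>
  if l = ν then fun x => 1 / ψ ν x else opA (ψ ν) (ψ l)

/-- `chainFamily ν ψ j l` is `ψ_l^{(N_j)}`, the image of `ψ l` by the chain of the first `j` DBTs
of spectral indices `N_j = (ν 0, …, ν (j-1))`. -/
def chainFamily (ν : ℕ → ℤ) (ψ : ℤ → ℝ → ℝ) : ℕ → ℤ → ℝ → ℝ
  | 0 => ψ
  | j + 1 => dbtFamily (ν j) (chainFamily ν ψ j)

/-- `chainPotential ν V ψ j` is `V^{(N_j)}`, the potential obtained from `V` by the first `j` DBTs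
of the chain; the seed of step `j + 1` is `chainFamily ν ψ j (ν j)`. -/
def chainPotential (ν : ℕ → ℤ) (V : ℝ → ℝ) (ψ : ℤ → ℝ → ℝ) : ℕ → ℝ → ℝ
  | 0 => V
  | j + 1 => dbtPotential (chainPotential ν V ψ j) (chainFamily ν ψ j (ν j))

/-- The Wronskian of `m` functions. -/
def wronskianFun {m : ℕ} (y : Fin m → ℝ → ℝ) (x : ℝ) : ℝ :=
  Matrix.det (Matrix.of fun i j : Fin m => iteratedDeriv (i : ℕ) (y j) x)

/-! ## Translationally shape invariant potentials -/

/-- The data of a family of potentials depending on a parameter `α ∈ ℝᴺ`. -/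
structure PotentialFamily (N : ℕ) where
  /-- the interval on which the potentials live -/
  I : Set ℝ
  /-- the range of the parameter for which the problem is regular and has bound states -/
  U : Set (Fin N → ℝ)
  /-- the translation of the parameter, `α_k = α + k ε` -/
  ε : Fin N → ℝ
  /-- the potential `V(x;α)` -/
  V : (Fin N → ℝ) → ℝ → ℝ
  /-- the ground state `ψ₀(x;α)` and its continuation in `α` -/
  ψ₀ : (Fin N → ℝ) → ℝ → ℝ
  /-- the additive constant of the shape invariance relation -/
  R : (Fin N → ℝ) → ℝ

namespace PotentialFamily

variable {N : ℕ} (T : PotentialFamily N)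

/-- `α_k = α + k ε`, `k ∈ ℤ`. -/
def shift (α : Fin N → ℝ) (k : ℤ) : Fin N → ℝ := α + (k : ℝ) • T.ε

/-- `E_n(α) = R(α_0) + … + R(α_{n-1})` for `n ≥ 0`. -/
def energyNat (n : ℕ) (α : Fin N → ℝ) : ℝ := ∑ k ∈ Finset.range n, T.R (T.shift α k)

/-- The dispersion relation for all integers: it is extended to negative indices by the identity
`E_{n+k}(α) - E_k(α) = E_n(α_k)`, that is `E_{-n}(α) = -E_n(α_{-n})`. -/
def energy : ℤ → (Fin N → ℝ) → ℝ
  | Int.ofNat n, α => T.energyNat n α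
  | Int.negSucc n, α => -T.energyNat (n + 1) (T.shift α (Int.negSucc n))

/-- `ψ_n(x;α) = A⁺(α) ψ_{n-1}(x;α_1) = A⁺(α) ⋯ A⁺(α_{n-1}) ψ₀(x;α_n)` for `n ≥ 0`, where
`A⁺(α) = -d/dx + w₀(x;α)`; it makes sense as a function of `α` also outside `U`. -/
def stateNat : ℕ → (Fin N → ℝ) → ℝ → ℝ
  | 0, α => T.ψ₀ α
  | n + 1, α => opAdj (T.ψ₀ α) (stateNat n (T.shift α 1))

/-- The eigenfunctions for all integers: `ψ_{-(n+1)}(x;α) = ψ_n(x;-α)`. -/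
def state : ℤ → (Fin N → ℝ) → ℝ → ℝ
  | Int.ofNat n, α => T.stateNat n α
  | Int.negSucc n, α => T.stateNat n (-α)

/-- The indices of the bound states of `V(x;α)`: `{0, …, n_max(α)}`, or all of `ℕ`. As `ψ_n(x;α)`
comes from the ground state at the parameter `α_n`, the level `n` is present as long as the
successive parameters `α_0, …, α_n` remain in `U`. -/
def levels (α : Fin N → ℝ) : Set ℕ := {n | ∀ k : ℕ, k ≤ n → T.shift α k ∈ T.U}

/-- Translational shape invariance at the value `α` of the parameter: the supersymmetric partner
`V^{(0)}(x;α) = V(x;α) + 2 w₀'(x;α)` is `V(x;α_1) + R(α)`, wherever `w₀` is defined. -/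
def ShapeInvariantAt (α : Fin N → ℝ) : Prop :=
  ∀ x ∈ T.I, T.ψ₀ α x ≠ 0 →
    dbtPotential (T.V α) (T.ψ₀ α) x = T.V (T.shift α 1) x + T.R α

/-- `T` is a translationally shape invariant potential (TSIP), with ground level `E₀ = 0`. -/
structure IsTSIP : Prop where
  isOpen : IsOpen T.I
  ordConnected : T.I.OrdConnected
  nonempty : T.I.Nonempty
  smooth_V : ∀ α ∈ T.U, ContDiffOn ℝ ∞ (T.V α) T.I
  smooth_ψ₀ : ∀ α ∈ T.U, ContDiffOn ℝ ∞ (T.ψ₀ α) T.I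
  spectrum : ∀ α ∈ T.U, IsDirichletSpectrum T.I (T.V α) (T.levels α)
    (fun n => T.energyNat n α) (fun n => T.stateNat n α)
  shapeInvariant : ∀ α ∈ T.U, T.shift α 1 ∈ T.U → T.ShapeInvariantAt α

/-- The discrete symmetry `Γ₃ : α ↦ -α`. The potential is covariant, the ground state and the shape
invariance continue to the reflected parameters (`(-α)_1 = -α_{-1}`), and the symmetrized ground
state `ψ_{-1}(x;α) = ψ₀(x;-α)` diverges at both ends of the interval, so that `1/ψ_{-1}` satisfies
the Dirichlet conditions (the DBT with seed `ψ_{-1}` is state-adding). Nothing is assumed on the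
zeros of `ψ_{-1}`, on its energy with respect to `V(x;α)`, or on the other `ψ_{-n}`. -/
structure HasGammaThree : Prop where
  covariant : ∀ α ∈ T.U, ∃ δ : ℝ, ∀ x ∈ T.I, T.V (-α) x = T.V α x + δ
  smooth_ψ₀ : ∀ α ∈ T.U, ContDiffOn ℝ ∞ (T.ψ₀ (-α)) T.I
  eigenfunction : ∀ α ∈ T.U, IsFormalEigenfunction T.I (T.V (-α)) 0 (T.ψ₀ (-α))
  shapeInvariant : ∀ α ∈ T.U, T.shift α (-1) ∈ T.U → T.ShapeInvariantAt (-α)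
  diverges : ∀ α ∈ T.U, T.shift α (-1) ∈ T.U → DivergesAtEnds T.I (T.state (-1) α)

/-- The spectral indices `(-1, -2, -3, …)` of the complete chains of state-adding DBTs. -/
def addingIndex (j : ℕ) : ℤ := -((j : ℤ) + 1)

/-- `V^{(-M)}(x;α)` for `-M = (-1, …, -m)`. -/
def extPotential (m : ℕ) (α : Fin N → ℝ) : ℝ → ℝ :=
  chainPotential addingIndex (T.V α) (fun l => T.state l α) m

/-- `ψ_l^{(-M)}(x;α)` for `-M = (-1, …, -m)`. -/
def extState (m : ℕ) (l : ℤ) (α : Fin N → ℝ) : ℝ → ℝ :=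
  chainFamily addingIndex (fun l => T.state l α) m l

end PotentialFamily

end

/-! ## Calculus on an open set -/

/-! The state-adding DBT with seed `ψ₋₁(·;α) = ψ₀(·;-α)` undoes, up to an additive constant in the
potential, the supersymmetric step from `α₋₁` to `α`. Everything else is iteration.

Neither `φ = ψ₀(·;α₋₁)` nor `ψ = ψ₀(·;-α)` has a zero. Shape invariance makes the partner potential
continuous on `I`, and the Riccati equation then reads `φ'² = G φ²` with `G` continuous, so a zero
would force `φ = 0` (`ne_zero_of_dbtPotential_eq`).

By covariance, `V(α)` and `V(α₋₁)` are partners of each other, up to constants, through both seeds.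
Adding the Riccati equations shows that `w_φ² - w_ψ²` is constant. The quotient `φ/ψ` vanishes at
both ends, so it has a critical point, where `w_φ = w_ψ`; the constant is therefore `0`. The branch
`w_φ = w_ψ` would make `φ/ψ` constant, which is excluded, so `w_ψ = -w_φ`
(`rsFun_eq_neg_of_partners`).

Hence `1/ψ ∼ φ` and `A(w_ψ) = -A⁺(w_φ)`: the DBT sends `ψ_l(α)` to a multiple of `ψ_{l+1}(α₋₁)`. For
`l ≤ -2` this uses `A⁺A f = E f` with `E < 0`. After `j` steps the system is that of `α₋ⱼ` with
shifted energies, and the next seed is again a nodeless `ψ₋₁`. The spectrum is thus read off from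
the one assumed at `α₋ₘ`, without any general theorem on adding levels. The Wronskian follows by
Crum's reduction along the same induction. -/

theorem deriv_eqOn_of_eqOn {I : Set ℝ} (hI : IsOpen I) {f g : ℝ → ℝ} (h : Set.EqOn f g I) :
    Set.EqOn (deriv f) (deriv g) I := fun _ hx =>
  (h.eventuallyEq_of_mem (hI.mem_nhds hx)).deriv_eq

theorem ContDiffOn.deriv_smooth {I : Set ℝ} (hI : IsOpen I) {f : ℝ → ℝ} (hf : ContDiffOn ℝ ∞ f I) :
    ContDiffOn ℝ ∞ (deriv f) I := hf.deriv_of_isOpen hI (by simp)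

theorem ContDiffOn.hasDerivAt_of_smooth {I : Set ℝ} (hI : IsOpen I) {f : ℝ → ℝ}
    (hf : ContDiffOn ℝ ∞ f I) {x : ℝ} (hx : x ∈ I) : HasDerivAt f (deriv f x) x :=
  ((hf.differentiableOn (by simp)).differentiableAt (hI.mem_nhds hx)).hasDerivAt

theorem contDiffOn_rsFun {I : Set ℝ} (hI : IsOpen I) {φ : ℝ → ℝ} (hφ : ContDiffOn ℝ ∞ φ I)
    (h0 : ∀ x ∈ I, φ x ≠ 0) : ContDiffOn ℝ ∞ (rsFun φ) I :=
  ((hφ.deriv_smooth hI).neg).div hφ h0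

theorem contDiffOn_opA {I : Set ℝ} (hI : IsOpen I) {φ f : ℝ → ℝ} (hφ : ContDiffOn ℝ ∞ φ I)
    (h0 : ∀ x ∈ I, φ x ≠ 0) (hf : ContDiffOn ℝ ∞ f I) : ContDiffOn ℝ ∞ (opA φ f) I :=
  (hf.deriv_smooth hI).add ((contDiffOn_rsFun hI hφ h0).mul hf)

/-- A function on an interval whose logarithmic derivative has a continuous square vanishes
identically as soon as it has a zero. -/
theorem eq_zero_of_deriv_sq_eq {I : Set ℝ} (hI : IsOpen I) (hc : I.OrdConnected) {f G : ℝ → ℝ}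
    (hf : ContDiffOn ℝ ∞ f I) (hG : ContinuousOn G I)
    (h : ∀ x ∈ I, deriv f x ^ 2 = G x * f x ^ 2) {a : ℝ} (ha : a ∈ I) (hfa : f a = 0) :
    ∀ x ∈ I, f x = 0 := by
  have bound : ∀ s : Set ℝ, IsCompact s → s ⊆ I → ∃ K : ℝ, ∀ x ∈ s, ‖deriv f x‖ ≤ K * ‖f x‖ := by
    intro s hs hsI
    obtain ⟨C, hC⟩ := hs.exists_bound_of_continuousOn (hG.mono hsI)
    -- `|C| + 1` is chosen because its square dominates `|C|`, hence `G`; no square root is needed.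
    refine ⟨|C| + 1, fun x hx => ?_⟩
    have h1 : G x ≤ (|C| + 1) ^ 2 := by
      have := (le_abs_self _).trans ((hC x hx).trans (le_abs_self C))
      nlinarith [abs_nonneg C]
    rw [Real.norm_eq_abs, Real.norm_eq_abs, ← abs_of_nonneg (by positivity : 0 ≤ |C| + 1), ← abs_mul,
      ← sq_le_sq, h x (hsI hx), mul_pow]
    exact mul_le_mul_of_nonneg_right h1 (sq_nonneg _)
  intro x hx
  rcases le_total a x with hax | hxa
  · have hs : Set.Icc a x ⊆ I := hc.out ha hx
    obtain ⟨K, hK⟩ := bound _ isCompact_Icc hs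
    exact eq_zero_of_abs_deriv_le_mul_abs_self_of_eq_zero_right (f' := deriv f) (K := K)
      (hf.continuousOn.mono hs)
      (fun y hy => (hf.hasDerivAt_of_smooth hI (hs (Set.Ico_subset_Icc_self hy))).hasDerivWithinAt)
      hfa (fun y hy => hK y (Set.Ico_subset_Icc_self hy)) x ⟨hax, le_rfl⟩
  -- The Gronwall estimate propagates a zero to the right only; the left side is reached by the
  -- reflection `t ↦ -t`.
  · have hs : Set.Icc x a ⊆ I := hc.out hx ha
    obtain ⟨K, hK⟩ := bound _ isCompact_Icc hs
    have hm : ∀ y ∈ Set.Icc (-a) (-x), -y ∈ Set.Icc x a := fun y hy =>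
      ⟨by linarith [hy.2], by linarith [hy.1]⟩
    have hd : ∀ y ∈ Set.Icc (-a) (-x), HasDerivAt (fun t => f (-t)) (-deriv f (-y)) y := by
      intro y hy
      have := (hf.hasDerivAt_of_smooth hI (hs (hm y hy))).comp y (hasDerivAt_neg y)
      exact this.congr_deriv (by simp)
    have := eq_zero_of_abs_deriv_le_mul_abs_self_of_eq_zero_right (f := fun t => f (-t))
      (f' := fun t => -deriv f (-t)) (K := K) (a := -a) (b := -x)
      (fun y hy => (hd y hy).continuousAt.continuousWithinAt)
      (fun y hy => (hd y (Set.Ico_subset_Icc_self hy)).hasDerivWithinAt)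
      (by simpa using hfa)
      (fun y hy => by simpa using hK _ (hm y (Set.Ico_subset_Icc_self hy)))
      (-x) ⟨by linarith, le_rfl⟩
    simpa using this

/-! ## Riccati equations and intertwining -/

theorem hasDerivAt_rsFun {φ : ℝ → ℝ} {x : ℝ} (h1 : HasDerivAt φ (deriv φ x) x)
    (h2 : HasDerivAt (deriv φ) (deriv (deriv φ) x) x) (h0 : φ x ≠ 0) :
    HasDerivAt (rsFun φ) (rsFun φ x ^ 2 - deriv (deriv φ) x / φ x) x := by
  have := h2.neg.div h1 h0
  refine this.congr_deriv ?_
  simp only [rsFun, Pi.neg_apply]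
  field_simp
  ring

/-- The Riccati form `w' = w² - V` of the zero-energy equation. The partner potential is then `2w² -
V`, so knowing it determines `w²`. -/
theorem hasDerivAt_rsFun_of_equation {I : Set ℝ} (hI : IsOpen I) {V φ : ℝ → ℝ}
    (hφ : ContDiffOn ℝ ∞ φ I) (heq : ∀ x ∈ I, -deriv (deriv φ) x + V x * φ x = 0 * φ x)
    {x : ℝ} (hx : x ∈ I) (h0 : φ x ≠ 0) :
    HasDerivAt (rsFun φ) (rsFun φ x ^ 2 - V x) x := by
  convert hasDerivAt_rsFun (hφ.hasDerivAt_of_smooth hI hx)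
    ((hφ.deriv_smooth hI).hasDerivAt_of_smooth hI hx) h0 using 2
  rw [eq_div_iff h0]
  linarith [heq x hx]

/-- If the supersymmetric partner of `V` extends continuously to `I`, the seed function of zero
energy has no zero. -/
theorem ne_zero_of_dbtPotential_eq {I : Set ℝ} (hI : IsOpen I) (hc : I.OrdConnected)
    {V W φ : ℝ → ℝ} (hφ : ContDiffOn ℝ ∞ φ I) (hV : ContinuousOn V I) (hW : ContinuousOn W I)
    (hE : IsFormalEigenfunction I V 0 φ)
    (h : ∀ x ∈ I, φ x ≠ 0 → dbtPotential V φ x = W x) : ∀ x ∈ I, φ x ≠ 0 := by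
  set G : ℝ → ℝ := fun x => (V x + W x) / 2
  have hG : ContinuousOn G I := (hV.add hW).div_const 2
  have hne : ∀ x ∈ I, φ x ≠ 0 → deriv φ x ^ 2 = G x * φ x ^ 2 := by
    intro x hx h0
    have h1 := h x hx h0
    rw [dbtPotential, (hasDerivAt_rsFun_of_equation hI hφ hE.equation hx h0).deriv] at h1
    have h2 : G x = rsFun φ x ^ 2 := by simp only [G]; linarith
    rw [h2, rsFun]
    field_simp
  have hall : ∀ x ∈ I, deriv φ x ^ 2 = G x * φ x ^ 2 := by
    intro x hx
    -- Either `x` is a limit of points where `φ ≠ 0`, and the identity passes to the limit, or `φ`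
    -- vanishes near `x` and both sides are `0`.
    by_cases hz : ∃ᶠ y in nhds x, φ y ≠ 0
    · have hcont : ContinuousAt (fun y => deriv φ y ^ 2 - G y * φ y ^ 2) x := by
        have hn := hI.mem_nhds hx
        exact (((hφ.deriv_smooth hI).continuousOn.continuousAt hn).pow 2).sub
          ((hG.continuousAt hn).mul ((hφ.continuousOn.continuousAt hn).pow 2))
      by_contra hcon
      have hev := hcont.eventually_ne (sub_ne_zero.2 hcon)
      obtain ⟨y, ⟨hy0, hy1⟩, hyI⟩ := ((hz.and_eventually hev).and_eventually (hI.mem_nhds hx)).exists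
      exact hy1 (sub_eq_zero.2 (hne y hyI hy0))
    · have hz' : φ =ᶠ[nhds x] fun _ => 0 := by
        have := Filter.not_frequently.1 hz
        filter_upwards [this] with y hy using not_not.1 hy
      rw [hz'.deriv_eq, hz'.eq_of_nhds]
      simp
  intro x hx h0
  obtain ⟨y, hy, hy0⟩ := hE.nontrivial
  exact hy0 (eq_zero_of_deriv_sq_eq hI hc hφ hG hall hx h0 y hy)

/-- The derivative of the image `A f` of a solution `f` of energy `E`. -/
theorem hasDerivAt_opA {I : Set ℝ} (hI : IsOpen I) {V φ f : ℝ → ℝ} {E : ℝ}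
    (hφ : ContDiffOn ℝ ∞ φ I) (h0 : ∀ x ∈ I, φ x ≠ 0)
    (hφE : ∀ x ∈ I, -deriv (deriv φ) x + V x * φ x = 0 * φ x) (hf : ContDiffOn ℝ ∞ f I)
    (hfE : ∀ x ∈ I, -deriv (deriv f) x + V x * f x = E * f x) {x : ℝ} (hx : x ∈ I) :
    HasDerivAt (opA φ f) (rsFun φ x * opA φ f x - E * f x) x := by
  have := ((hf.deriv_smooth hI).hasDerivAt_of_smooth hI hx).add
    ((hasDerivAt_rsFun_of_equation hI hφ hφE hx (h0 x hx)).mul (hf.hasDerivAt_of_smooth hI hx))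
  refine this.congr_deriv ?_
  rw [opA]
  linear_combination -hfE x hx

/-- `A⁺ A f = E f` for a solution `f` of energy `E`, the seed having zero energy. -/
theorem opAdj_opA {I : Set ℝ} (hI : IsOpen I) {V φ f : ℝ → ℝ} {E : ℝ}
    (hφ : ContDiffOn ℝ ∞ φ I) (h0 : ∀ x ∈ I, φ x ≠ 0)
    (hφE : ∀ x ∈ I, -deriv (deriv φ) x + V x * φ x = 0 * φ x) (hf : ContDiffOn ℝ ∞ f I)
    (hfE : ∀ x ∈ I, -deriv (deriv f) x + V x * f x = E * f x) {x : ℝ} (hx : x ∈ I) :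
    opAdj φ (opA φ f) x = E * f x := by
  rw [opAdj, (hasDerivAt_opA hI hφ h0 hφE hf hfE hx).deriv]
  ring

/-- The Darboux transformation maps solutions to solutions of the same energy. -/
theorem equation_opA {I : Set ℝ} (hI : IsOpen I) {V φ f : ℝ → ℝ} {E : ℝ}
    (hφ : ContDiffOn ℝ ∞ φ I) (h0 : ∀ x ∈ I, φ x ≠ 0)
    (hφE : ∀ x ∈ I, -deriv (deriv φ) x + V x * φ x = 0 * φ x) (hf : ContDiffOn ℝ ∞ f I)
    (hfE : ∀ x ∈ I, -deriv (deriv f) x + V x * f x = E * f x) {x : ℝ} (hx : x ∈ I) :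
    -deriv (deriv (opA φ f)) x + dbtPotential V φ x * opA φ f x = E * opA φ f x := by
  have h1 : Set.EqOn (deriv (opA φ f)) (fun x => rsFun φ x * opA φ f x - E * f x) I :=
    fun y hy => (hasDerivAt_opA hI hφ h0 hφE hf hfE hy).deriv
  have hw := hasDerivAt_rsFun_of_equation hI hφ hφE hx (h0 x hx)
  have hg := hasDerivAt_opA hI hφ h0 hφE hf hfE hx
  have hd := (hw.mul hg).sub ((hf.hasDerivAt_of_smooth hI hx).const_mul E)
  rw [deriv_eqOn_of_eqOn hI h1 hx]
  have : deriv (fun x => rsFun φ x * opA φ f x - E * f x) x = _ := hd.deriv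
  rw [this, dbtPotential, hw.deriv]
  have : deriv f x = opA φ f x - rsFun φ x * f x := by rw [opA]; ring
  rw [this]
  ring

/-! ## Rigidity of a pair of superpartners -/

/-- A function with no zero which vanishes at both ends of `I` has a critical point. -/
theorem VanishesAtEnds.exists_deriv_eq_zero {I : Set ℝ} (hI : IsOpen I) {P : ℝ → ℝ}
    (hP : VanishesAtEnds I P) (hd : DifferentiableOn ℝ P I) {a : ℝ} (ha : a ∈ I)
    (h0 : ∀ x ∈ I, P x ≠ 0) : ∃ x ∈ I, deriv P x = 0 := by
  obtain ⟨K, hKI, hK, hKP⟩ := hP |P a| (abs_pos.2 (h0 a ha))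
  have hsub : insert a K ⊆ I := Set.insert_subset ha hKI
  obtain ⟨b, hb, hmax⟩ := (hK.insert a).exists_isMaxOn (Set.insert_nonempty a K)
    (f := fun x => |P x|) ((hd.continuousOn.mono hsub).abs)
  have hbI := hsub hb
  have hmaxI : ∀ x ∈ I, |P x| ≤ |P b| := by
    intro x hx
    by_cases hxK : x ∈ K
    · exact hmax (Set.mem_insert_of_mem a hxK)
    · exact (hKP x ⟨hx, hxK⟩).le.trans (hmax (Set.mem_insert a K))
  -- Squaring gives a differentiable function with the same maximum point as `|P|`, whatever the
  -- sign of `P`.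
  have hloc : IsLocalMax (fun x => P x ^ 2) b := by
    filter_upwards [hI.mem_nhds hbI] with x hx
    exact sq_le_sq.2 (hmaxI x hx)
  have hdb := (hd.differentiableAt (hI.mem_nhds hbI)).hasDerivAt
  have := hloc.hasDerivAt_eq_zero (hdb.pow 2)
  refine ⟨b, hbI, ?_⟩
  simpa [h0 b hbI] using this

theorem VanishesAtEnds.not_const {I : Set ℝ} (hI : IsOpen I) {P : ℝ → ℝ}
    (hP : VanishesAtEnds I P) {a : ℝ} (ha : a ∈ I) (h0 : P a ≠ 0) :
    ¬ ∀ x ∈ I, P x = P a := by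
  intro hconst
  obtain ⟨K, hKI, hK, hKP⟩ := hP |P a| (abs_pos.2 h0)
  -- Constancy would make `I` compact as well as open, which is impossible for a nonempty subset of
  -- `ℝ`.
  have hIK : I = K := by
    refine Set.Subset.antisymm (fun x hx => ?_) hKI
    by_contra hxK
    exact absurd (hKP x ⟨hx, hxK⟩) (by simp [hconst x hx])
  have hcl : IsClopen K := ⟨hK.isClosed, hIK ▸ hI⟩
  rcases isClopen_iff.1 hcl with h | h
  · rw [← hIK] at h
    simp [h] at ha
  · rw [h] at hK
    exact noncompact_univ ℝ hK

theorem VanishesAtEnds.div {I : Set ℝ} {φ ψ : ℝ → ℝ} (hφ : VanishesAtEnds I φ)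
    (hψ : DivergesAtEnds I ψ) : VanishesAtEnds I (fun x => φ x / ψ x) := by
  intro η hη
  obtain ⟨K, hKI, hK, h1⟩ := hφ η hη
  obtain ⟨L, hLI, hL, h2⟩ := hψ 1
  refine ⟨K ∪ L, Set.union_subset hKI hLI, hK.union hL, fun x hx => ?_⟩
  have hxK := h1 x ⟨hx.1, fun h => hx.2 (Or.inl h)⟩
  have hxL := h2 x ⟨hx.1, fun h => hx.2 (Or.inr h)⟩
  rw [abs_div]
  exact (div_le_self (abs_nonneg _) hxL.le).trans_lt hxK

/-- Two potentials `A` and `B` that are superpartners of each other, up to constants, through a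
vanishing seed `φ` and a diverging seed `ψ`: the two seeds are inverse to each other. -/
theorem rsFun_eq_neg_of_partners {I : Set ℝ} (hI : IsOpen I) (hc : I.OrdConnected)
    (hne : I.Nonempty) {A B φ ψ : ℝ → ℝ} {r s δ : ℝ}
    (hφ : ContDiffOn ℝ ∞ φ I) (hφ0 : ∀ x ∈ I, φ x ≠ 0)
    (hφE : ∀ x ∈ I, -deriv (deriv φ) x + B x * φ x = 0 * φ x)
    (hψ : ContDiffOn ℝ ∞ ψ I) (hψ0 : ∀ x ∈ I, ψ x ≠ 0)
    (hψE : ∀ x ∈ I, -deriv (deriv ψ) x + (A x + δ) * ψ x = 0 * ψ x)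
    (h1 : ∀ x ∈ I, B x + 2 * deriv (rsFun φ) x = A x + r)
    (h2 : ∀ x ∈ I, A x + δ + 2 * deriv (rsFun ψ) x = B x + s)
    (hv : VanishesAtEnds I φ) (hdiv : DivergesAtEnds I ψ) :
    (∀ x ∈ I, rsFun ψ x = -rsFun φ x) ∧ δ = r := by
  have hpre : IsPreconnected I := hc.isPreconnected
  obtain ⟨a, ha⟩ := hne
  have dw0 : ∀ x ∈ I, HasDerivAt (rsFun φ) (rsFun φ x ^ 2 - B x) x := fun x hx =>
    hasDerivAt_rsFun_of_equation hI hφ hφE hx (hφ0 x hx)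
  have dw : ∀ x ∈ I, HasDerivAt (rsFun ψ) (rsFun ψ x ^ 2 - (A x + δ)) x := fun x hx =>
    hasDerivAt_rsFun_of_equation (V := fun x => A x + δ) hI hψ hψE hx (hψ0 x hx)
  have e1 : ∀ x ∈ I, 2 * rsFun φ x ^ 2 = A x + B x + r := fun x hx => by
    have := h1 x hx
    rw [(dw0 x hx).deriv] at this
    linarith
  have e2 : ∀ x ∈ I, 2 * rsFun ψ x ^ 2 = A x + B x + δ + s := fun x hx => by
    have := h2 x hx
    rw [(dw x hx).deriv] at this
    linarith
  set P : ℝ → ℝ := fun x => φ x / ψ x with hPdef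
  have hP0 : ∀ x ∈ I, P x ≠ 0 := fun x hx => div_ne_zero (hφ0 x hx) (hψ0 x hx)
  have dP : ∀ x ∈ I, HasDerivAt P (P x * (rsFun ψ x - rsFun φ x)) x := by
    intro x hx
    have := (hφ.hasDerivAt_of_smooth hI hx).div (hψ.hasDerivAt_of_smooth hI hx) (hψ0 x hx)
    refine this.congr_deriv ?_
    have := hφ0 x hx
    have := hψ0 x hx
    simp only [P, rsFun]
    field_simp
    ring
  have hPd : DifferentiableOn ℝ P I := fun x hx => (dP x hx).differentiableAt.differentiableWithinAt
  have hPv : VanishesAtEnds I P := hv.div hdiv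
  -- The difference of squares is constant by `e1` and `e2`, and it vanishes at a critical point of
  -- `P`.
  have hprod : ∀ x ∈ I, (rsFun φ x + rsFun ψ x) * (rsFun φ x - rsFun ψ x) = 0 := by
    obtain ⟨b, hb, hb0⟩ := hPv.exists_deriv_eq_zero hI hPd ha hP0
    rw [(dP b hb).deriv] at hb0
    have hbw : rsFun ψ b - rsFun φ b = 0 := (mul_eq_zero.1 hb0).resolve_left (hP0 b hb)
    intro x hx
    have hb' : rsFun ψ b = rsFun φ b := by linarith
    have := e2 b hb
    rw [hb'] at this
    linear_combination (e1 x hx - e2 x hx) / 2 + (this - e1 b hb) / 2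
  have hnot : ¬ ∀ x ∈ I, rsFun φ x - rsFun ψ x = 0 := by
    intro hD
    refine hPv.not_const hI ha (hP0 a ha) fun x hx =>
      hI.is_const_of_deriv_eq_zero hpre hPd (fun y hy => ?_) hx ha
    rw [(dP y hy).deriv]
    have := hD y hy
    rw [Pi.zero_apply, mul_eq_zero]
    right
    linarith
  -- The product vanishes pointwise only; the next steps select one factor globally. By `e1` and
  -- `e2` the sum `w_φ + w_ψ` has constant derivative `d`.
  set d : ℝ := (r + s - δ) / 2 with hd
  have ds : ∀ x ∈ I, HasDerivAt (fun x => rsFun φ x + rsFun ψ x) d x := by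
    intro x hx
    have := (dw0 x hx).add (dw x hx)
    refine this.congr_deriv ?_
    linarith [e1 x hx, e2 x hx]
  have hd0 : d = 0 := by
    by_contra hdne
    refine hnot fun x hx => ?_
    have hD := (dw0 x hx).sub (dw x hx)
    -- Differentiating sum times difference `= 0` and multiplying by the difference leaves `d ·
    -- (difference)² = 0`.
    have h3 := ((ds x hx).mul hD).congr_of_eventuallyEq (f₁ := fun _ => 0)
      (by filter_upwards [hI.mem_nhds hx] with y hy using (hprod y hy).symm)
    have h4 := h3.unique (hasDerivAt_const x (0 : ℝ))
    have h5 : d * (rsFun φ x - rsFun ψ x) ^ 2 = 0 := by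
      simp only [Pi.sub_apply] at h4
      linear_combination (rsFun φ x - rsFun ψ x) * h4 -
        (rsFun φ x ^ 2 - B x - (rsFun ψ x ^ 2 - (A x + δ))) * hprod x hx
    simpa [hdne] using h5
  have hconst : ∀ x ∈ I, ∀ y ∈ I, rsFun φ x + rsFun ψ x = rsFun φ y + rsFun ψ y :=
    fun x hx y hy => hI.is_const_of_deriv_eq_zero hpre
      (fun z hz => (ds z hz).differentiableAt.differentiableWithinAt)
      (fun z hz => by rw [(ds z hz).deriv, hd0, Pi.zero_apply]) hx hy
  have hw : ∀ x ∈ I, rsFun ψ x = -rsFun φ x := by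
    intro x hx
    by_contra hcon
    refine hnot fun y hy => (mul_eq_zero.1 (hprod y hy)).resolve_left fun h => hcon ?_
    linarith [hconst x hx y hy]
  refine ⟨hw, ?_⟩
  have h3 := e1 a ha
  have h4 := e2 a ha
  rw [hw a ha, neg_sq] at h4
  linarith

/-- Seeds with opposite logarithmic derivatives are inverse to each other. -/
theorem propOn_one_div_of_rsFun_eq_neg {I : Set ℝ} (hI : IsOpen I) (hc : I.OrdConnected)
    (hne : I.Nonempty) {φ ψ : ℝ → ℝ} (hφ : ContDiffOn ℝ ∞ φ I) (hφ0 : ∀ x ∈ I, φ x ≠ 0)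
    (hψ : ContDiffOn ℝ ∞ ψ I) (hψ0 : ∀ x ∈ I, ψ x ≠ 0)
    (h : ∀ x ∈ I, rsFun ψ x = -rsFun φ x) : PropOn I (fun x => 1 / ψ x) φ := by
  obtain ⟨a, ha⟩ := hne
  have dP : ∀ x ∈ I, HasDerivAt (fun x => φ x * ψ x) 0 x := by
    intro x hx
    refine ((hφ.hasDerivAt_of_smooth hI hx).mul (hψ.hasDerivAt_of_smooth hI hx)).congr_deriv ?_
    have h1 := h x hx
    have := hφ0 x hx
    have := hψ0 x hx
    simp only [rsFun] at h1
    field_simp at h1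
    linarith
  refine ⟨1 / (φ a * ψ a), one_div_ne_zero (mul_ne_zero (hφ0 a ha) (hψ0 a ha)), fun x hx => ?_⟩
  have h1 : φ x * ψ x = φ a * ψ a := hI.is_const_of_deriv_eq_zero hc.isPreconnected
    (fun z hz => (dP z hz).differentiableAt.differentiableWithinAt)
    (fun z hz => (dP z hz).deriv) hx ha
  have := hφ0 x hx
  have := hψ0 x hx
  rw [← h1]
  field_simp

/-! ## Equality up to a constant factor -/

theorem PropOn.refl (I : Set ℝ) (f : ℝ → ℝ) : PropOn I f f := ⟨1, one_ne_zero, fun _ _ => by simp⟩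

theorem PropOn.symm {I : Set ℝ} {f g : ℝ → ℝ} (h : PropOn I f g) : PropOn I g f := by
  obtain ⟨c, hc, h⟩ := h
  exact ⟨c⁻¹, inv_ne_zero hc, fun x hx => by rw [h x hx, inv_mul_cancel_left₀ hc]⟩

theorem PropOn.trans {I : Set ℝ} {f g h : ℝ → ℝ} (h1 : PropOn I f g) (h2 : PropOn I g h) :
    PropOn I f h := by
  obtain ⟨c, hc, h1⟩ := h1
  obtain ⟨d, hd, h2⟩ := h2
  exact ⟨c * d, mul_ne_zero hc hd, fun x hx => by rw [h1 x hx, h2 x hx, mul_assoc]⟩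

theorem PropOn.ne_zero {I : Set ℝ} {f g : ℝ → ℝ} (h : PropOn I f g) {x : ℝ} (hx : x ∈ I)
    (hg : g x ≠ 0) : f x ≠ 0 := by
  obtain ⟨c, hc, h⟩ := h
  rw [h x hx]
  exact mul_ne_zero hc hg

theorem PropOn.one_div {I : Set ℝ} {f g : ℝ → ℝ} (h : PropOn I f g) :
    PropOn I (fun x => 1 / f x) (fun x => 1 / g x) := by
  obtain ⟨c, hc, h⟩ := h
  refine ⟨1 / c, one_div_ne_zero hc, fun x hx => ?_⟩
  show 1 / f x = 1 / c * (1 / g x)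
  rw [h x hx, one_div_mul_one_div]

theorem deriv_eqOn_const_mul {I : Set ℝ} (hI : IsOpen I) {f g : ℝ → ℝ} {c : ℝ}
    (h : ∀ x ∈ I, f x = c * g x) : ∀ x ∈ I, deriv f x = c * deriv g x := by
  intro x hx
  rw [deriv_eqOn_of_eqOn hI (show Set.EqOn f (fun x => c * g x) I from h) hx]
  exact deriv_const_mul_field c

theorem PropOn.rsFun_eq {I : Set ℝ} (hI : IsOpen I) {f g : ℝ → ℝ} (h : PropOn I f g) :
    Set.EqOn (rsFun f) (rsFun g) I := by
  obtain ⟨c, hc, h⟩ := h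
  intro x hx
  rw [rsFun, rsFun, deriv_eqOn_const_mul hI h x hx, h x hx, ← mul_neg, mul_div_mul_left _ _ hc]

theorem PropOn.dbtPotential_eq {I : Set ℝ} (hI : IsOpen I) {V f g : ℝ → ℝ} (h : PropOn I f g)
    {x : ℝ} (hx : x ∈ I) : dbtPotential V f x = V x + 2 * deriv (rsFun g) x := by
  rw [dbtPotential, deriv_eqOn_of_eqOn hI (h.rsFun_eq hI) hx]

theorem PropOn.opA {I : Set ℝ} (hI : IsOpen I) {φ χ f g : ℝ → ℝ} (hφ : PropOn I φ χ)
    (h : PropOn I f g) : PropOn I (opA φ f) (opA χ g) := by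
  obtain ⟨c, hc, h⟩ := h
  refine ⟨c, hc, fun x hx => ?_⟩
  rw [_root_.opA, _root_.opA, deriv_eqOn_const_mul hI h x hx, h x hx, hφ.rsFun_eq hI hx]
  ring

theorem PropOn.opAdj {I : Set ℝ} (hI : IsOpen I) (φ : ℝ → ℝ) {f g : ℝ → ℝ}
    (h : PropOn I f g) : PropOn I (opAdj φ f) (opAdj φ g) := by
  obtain ⟨c, hc, h⟩ := h
  refine ⟨c, hc, fun x hx => ?_⟩
  rw [_root_.opAdj, _root_.opAdj, deriv_eqOn_const_mul hI h x hx, h x hx]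
  ring

theorem propOn_opA_opAdj {I : Set ℝ} {φ ψ : ℝ → ℝ} (h : ∀ x ∈ I, rsFun ψ x = -rsFun φ x)
    (f : ℝ → ℝ) : PropOn I (opA ψ f) (opAdj φ f) :=
  ⟨-1, by norm_num, fun x hx => by rw [opA, opAdj, h x hx]; ring⟩

theorem propOn_opAdj_opA {I : Set ℝ} {φ ψ : ℝ → ℝ} (h : ∀ x ∈ I, rsFun ψ x = -rsFun φ x)
    (f : ℝ → ℝ) : PropOn I (opAdj ψ f) (opA φ f) :=
  ⟨-1, by norm_num, fun x hx => by rw [opA, opAdj, h x hx]; ring⟩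

theorem IsFormalEigenfunction.of_propOn {I : Set ℝ} (hI : IsOpen I) {V W f g : ℝ → ℝ} {E s : ℝ}
    (hg : IsFormalEigenfunction I W E g) (h : PropOn I f g) (hV : ∀ x ∈ I, V x = W x + s) :
    IsFormalEigenfunction I V (E + s) f := by
  obtain ⟨c, hc, h⟩ := h
  refine ⟨(contDiffOn_const.mul hg.contDiffOn).congr h, fun x hx => ?_, ?_⟩
  · rw [deriv_eqOn_const_mul hI (deriv_eqOn_const_mul hI h) x hx, h x hx, hV x hx]
    linear_combination c * hg.equation x hx
  · obtain ⟨x, hx, hx0⟩ := hg.nontrivial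
    exact ⟨x, hx, by rw [h x hx]; exact mul_ne_zero hc hx0⟩

theorem IsEigenstate.of_propOn {I : Set ℝ} (hI : IsOpen I) {V W f g : ℝ → ℝ} {E s : ℝ}
    (hg : IsEigenstate I W E g) (h : PropOn I f g) (hV : ∀ x ∈ I, V x = W x + s) :
    IsEigenstate I V (E + s) f := by
  refine ⟨hg.toIsFormalEigenfunction.of_propOn hI h hV, fun η hη => ?_⟩
  obtain ⟨c, hc, h⟩ := h
  obtain ⟨K, hKI, hK, hKg⟩ := hg.dirichlet (η / |c|) (div_pos hη (abs_pos.2 hc))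
  refine ⟨K, hKI, hK, fun x hx => ?_⟩
  have := hKg x hx
  rw [lt_div_iff₀ (abs_pos.2 hc)] at this
  rwa [h x hx.1, abs_mul, mul_comm]

theorem IsDirichletSpectrum.of_propOn {I : Set ℝ} (hI : IsOpen I) {V W : ℝ → ℝ} {L : Set ℕ}
    {e e' : ℕ → ℝ} {φ χ : ℕ → ℝ → ℝ} {s : ℝ} (h : IsDirichletSpectrum I W L e φ)
    (hV : ∀ x ∈ I, V x = W x + s) (he : ∀ n, e' n = e n + s) (hχ : ∀ n, PropOn I (χ n) (φ n)) :
    IsDirichletSpectrum I V L e' χ where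
  eigenstate n hn := by
    rw [he]
    exact (h.eigenstate n hn).of_propOn hI (hχ n) hV
  increasing a ha b hb hab := by
    rw [he, he]
    exact add_lt_add_left (h.increasing ha hb hab) s
  complete E f hf := by
    obtain ⟨n, hn, hE, hp⟩ := h.complete (E + -s) f
      (hf.of_propOn hI (PropOn.refl I f) fun x hx => by rw [hV x hx]; ring)
    exact ⟨n, hn, by rw [he]; linarith, hp.trans (hχ n).symm⟩

/-- A DBT treats its seed separately, so two families with different labellings can be compared only
if `l` and `k` are seeds simultaneously. -/
theorem dbtFamily_propOn {I : Set ℝ} (hI : IsOpen I) {ν l μ k : ℤ} {ψ χ : ℤ → ℝ → ℝ}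
    (hν : PropOn I (ψ ν) (χ μ)) (hl : PropOn I (ψ l) (χ k)) (hiff : l = ν ↔ k = μ) :
    PropOn I (dbtFamily ν ψ l) (dbtFamily μ χ k) := by
  rw [dbtFamily, dbtFamily]
  by_cases h : l = ν
  · rw [if_pos h, if_pos (hiff.1 h)]
    exact hν.one_div
  · rw [if_neg h, if_neg (mt hiff.2 h)]
    exact hν.opA hI hl

/-! ## Wronskians -/

/-- The kernel formulation lets Crum's reduction act on linear relations, with no determinant
identity. -/
theorem wronskianFun_ne_zero_iff {m : ℕ} {y : Fin m → ℝ → ℝ} {x : ℝ} :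
    wronskianFun y x ≠ 0 ↔ ∀ c : Fin m → ℝ,
      (∀ k : ℕ, k < m → ∑ j, c j * iteratedDeriv k (y j) x = 0) → c = 0 := by
  rw [wronskianFun, Ne, ← Matrix.exists_mulVec_eq_zero_iff]
  push Not
  refine forall_congr' fun c => ?_
  have : Matrix.mulVec (Matrix.of fun i j : Fin m => iteratedDeriv (i : ℕ) (y j) x) c = 0 ↔
      ∀ k : ℕ, k < m → ∑ j, c j * iteratedDeriv k (y j) x = 0 := by
    rw [funext_iff, Fin.forall_iff]
    refine forall₂_congr fun k hk => ?_
    simp [Matrix.mulVec, dotProduct, mul_comm]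
  exact ⟨fun h hc => by_contra fun h0 => h h0 (this.2 hc), fun h h0 hc => h0 (h (this.1 hc))⟩

theorem iteratedDeriv_opA {I : Set ℝ} (hI : IsOpen I) {φ f : ℝ → ℝ} (hφ : ContDiffOn ℝ ∞ φ I)
    (h0 : ∀ x ∈ I, φ x ≠ 0) (hf : ContDiffOn ℝ ∞ f I) {x : ℝ} (hx : x ∈ I) (k : ℕ) :
    iteratedDeriv k (opA φ f) x = iteratedDeriv (k + 1) f x +
      ∑ i ∈ Finset.range (k + 1),
        (k.choose i : ℝ) * iteratedDeriv i (rsFun φ) x * iteratedDeriv (k - i) f x := by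
  have hk : ∀ {g : ℝ → ℝ}, ContDiffOn ℝ ∞ g I → ContDiffAt ℝ k g x := fun hg =>
    (hg.contDiffAt (hI.mem_nhds hx)).of_le (by exact_mod_cast le_top)
  have hw := contDiffOn_rsFun hI hφ h0
  have : opA φ f = deriv f + rsFun φ * f := rfl
  rw [this, iteratedDeriv_add (hk (hf.deriv_smooth hI)) (g := rsFun φ * f) (hk (hw.mul hf)), ← iteratedDeriv_succ',
    iteratedDeriv_mul (hk hw) (hk hf)]

/-- Crum's reduction: a Wronskian has no zero if its first entry and the Wronskian of the images
of the other entries have none. -/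
theorem wronskianFun_ne_zero_of_opA {I : Set ℝ} (hI : IsOpen I) {m : ℕ} {y : Fin (m + 1) → ℝ → ℝ}
    {z : Fin m → ℝ → ℝ} (hy : ∀ i, ContDiffOn ℝ ∞ (y i) I) (h0 : ∀ x ∈ I, y 0 x ≠ 0)
    (hz : ∀ i : Fin m, PropOn I (opA (y 0) (y i.succ)) (z i)) {x : ℝ} (hx : x ∈ I)
    (h : wronskianFun z x ≠ 0) : wronskianFun y x ≠ 0 := by
  rw [wronskianFun_ne_zero_iff] at h ⊢
  intro c hc
  -- By Leibniz, the `k`-th derivative of `A f` involves derivatives of `f` of order at most `k + 1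
  -- ≤ m`, with coefficients independent of `f`; relations among the `y j` therefore pass to the
  -- images.
  have hopA : ∀ k < m, ∑ j, c j * iteratedDeriv k (opA (y 0) (y j)) x = 0 := by
    intro k hk
    simp_rw [fun j => iteratedDeriv_opA hI (hy 0) h0 (hy j) hx k, mul_add, Finset.sum_add_distrib,
      hc (k + 1) (by omega), Finset.mul_sum]
    rw [Finset.sum_comm, zero_add]
    refine Finset.sum_eq_zero fun i hi => ?_
    have := hc (k - i) (by omega)
    calc _ = ((k.choose i : ℝ) * iteratedDeriv i (rsFun (y 0)) x) *
          ∑ j, c j * iteratedDeriv (k - i) (y j) x := by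
            rw [Finset.mul_sum]
            exact Finset.sum_congr rfl fun j _ => by ring
      _ = 0 := by rw [this, mul_zero]
  have hz0 : ∀ k, iteratedDeriv k (opA (y 0) (y 0)) x = 0 := by
    intro k
    have : opA (y 0) (y 0) =ᶠ[nhds x] fun _ => 0 := by
      filter_upwards [hI.mem_nhds hx] with t ht
      rw [opA, rsFun, div_mul_cancel₀ _ (h0 t ht)]
      ring
    rw [this.iteratedDeriv_eq]
    simp
  choose κ hκ0 hκ using hz
  have hsucc : (fun i : Fin m => c i.succ * κ i) = 0 := by
    refine h _ fun k hk => ?_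
    have := hopA k hk
    rw [Fin.sum_univ_succ, hz0, mul_zero, zero_add] at this
    rw [← this]
    refine Finset.sum_congr rfl fun i _ => ?_
    have : opA (y 0) (y i.succ) =ᶠ[nhds x] fun t => κ i * z i t := by
      filter_upwards [hI.mem_nhds hx] with t ht using hκ i t ht
    rw [this.iteratedDeriv_eq, iteratedDeriv_const_mul_field, mul_assoc]
  have hs : ∀ i : Fin m, c i.succ = 0 := fun i =>
    (mul_eq_zero.1 (congrFun hsucc i)).resolve_right (hκ0 i)
  funext i
  refine Fin.cases ?_ hs i
  have := hc 0 (by omega)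
  rw [Fin.sum_univ_succ] at this
  simpa [hs, h0 x hx] using this

namespace PotentialFamily

variable {N : ℕ} {T : PotentialFamily N}

/-! ## Parameters and energies -/

theorem shift_shift (α : Fin N → ℝ) (a b : ℤ) : T.shift (T.shift α a) b = T.shift α (a + b) := by
  simp only [shift]
  push_cast
  rw [add_smul, add_assoc]

theorem shift_zero (α : Fin N → ℝ) : T.shift α 0 = α := by simp [shift]

theorem shift_neg_one (α : Fin N → ℝ) : T.shift (-α) 1 = -T.shift α (-1) := by
  simp only [shift]
  push_cast
  module

theorem energyNat_add (a b : ℕ) (α : Fin N → ℝ) :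
    T.energyNat (a + b) α = T.energyNat a α + T.energyNat b (T.shift α a) := by
  simp only [energyNat, Finset.sum_range_add, shift_shift]
  push_cast
  rfl

theorem energy_natCast (n : ℕ) (α : Fin N → ℝ) : T.energy n α = T.energyNat n α := rfl

theorem energy_neg_natCast (n : ℕ) (α : Fin N → ℝ) :
    T.energy (-(n : ℤ)) α = -T.energyNat n (T.shift α (-(n : ℤ))) := by
  cases n with
  | zero => simp [energy, energyNat]
  | succ n => rfl

theorem energy_sub (j m : ℕ) (α : Fin N → ℝ) :
    T.energy ((j : ℤ) - m) α
      = T.energyNat j (T.shift α (-(m : ℤ))) + T.energy (-(m : ℤ)) α := by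
  rw [energy_neg_natCast]
  rcases le_total m j with h | h
  · obtain ⟨k, rfl⟩ := Nat.exists_eq_add_of_le h
    rw [energyNat_add, shift_shift, neg_add_cancel, shift_zero,
      show ((m + k : ℕ) : ℤ) - m = (k : ℤ) by push_cast; ring, energy_natCast]
    ring
  · obtain ⟨k, rfl⟩ := Nat.exists_eq_add_of_le h
    rw [energyNat_add, shift_shift, show (j : ℤ) - ((j + k : ℕ) : ℤ) = -(k : ℤ) by push_cast; ring,
      energy_neg_natCast, show -((j + k : ℕ) : ℤ) + (j : ℤ) = -(k : ℤ) by push_cast; ring]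
    ring

/-- Detaches the first summand, as needed to append a step to the chain; the primed version detaches
the last one, for inductions that replace `α` by `α₋₁`. -/
theorem energy_neg_succ (j : ℕ) (α : Fin N → ℝ) :
    T.energy (-((j : ℤ) + 1)) α
      = T.energy (-(j : ℤ)) α - T.R (T.shift α (-((j : ℤ) + 1))) := by
  have h := energy_neg_natCast (T := T) (j + 1) α
  push_cast at h
  rw [h, energy_neg_natCast, add_comm j 1, energyNat_add, shift_shift]
  have : -((j : ℤ) + 1) + ((1 : ℕ) : ℤ) = -(j : ℤ) := by push_cast; ring
  rw [this]
  simp [energyNat, shift_zero]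
  ring

theorem energy_neg_succ' (j : ℕ) (α : Fin N → ℝ) :
    T.energy (-((j : ℤ) + 1)) α
      = T.energy (-(j : ℤ)) (T.shift α (-1)) - T.R (T.shift α (-1)) := by
  have h := energy_neg_natCast (T := T) (j + 1) α
  push_cast at h
  rw [h, energy_neg_natCast, energyNat_add, shift_shift, shift_shift]
  have : -((j : ℤ) + 1) + (j : ℤ) = -1 := by ring
  rw [this, show -1 + -(j : ℤ) = -((j : ℤ) + 1) by ring]
  simp [energyNat, shift_zero]
  ring

/-! ## The seed functions `ψ₀(x;α₋₁)` and `ψ₋₁(x;α)` -/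

theorem IsTSIP.equation_ψ₀ (hT : T.IsTSIP) {α : Fin N → ℝ} (hα : α ∈ T.U) :
    IsEigenstate T.I (T.V α) 0 (T.ψ₀ α) := by
  have h := (hT.spectrum α hα).eigenstate 0
    (fun k hk => by simpa [Nat.le_zero.1 hk, shift_zero] using hα)
  simpa [energyNat, stateNat] using h

/-- The number `-E_{-(k+1)}(α)` is the excited level `k + 1` of the potential at `α_{-(k+1)}`, whose
ground level is `0`. -/
theorem IsTSIP.energy_neg (hT : T.IsTSIP) {α : Fin N → ℝ} {k : ℕ}
    (hα : ∀ j : ℕ, j ≤ k + 1 → T.shift α (-(j : ℤ)) ∈ T.U) :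
    T.energy (-((k : ℤ) + 1)) α < 0 := by
  have h := energy_neg_natCast (T := T) (k + 1) α
  have hU := hα (k + 1) le_rfl
  push_cast at h hU
  have hlev : ∀ n ≤ k + 1, n ∈ T.levels (T.shift α (-((k : ℤ) + 1))) := by
    intro n hn i hi
    rw [shift_shift]
    convert hα (k + 1 - i) (by omega) using 2
    push_cast [Nat.cast_sub (hi.trans hn)]
    ring
  have := (hT.spectrum _ hU).increasing (hlev 0 (by omega)) (hlev (k + 1) le_rfl) (by omega)
  simp only [energyNat, Finset.range_zero, Finset.sum_empty] at this
  rw [h]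
  simpa [energyNat] using this

theorem IsTSIP.ψ₀_ne_zero (hT : T.IsTSIP) {α : Fin N → ℝ} (hα : α ∈ T.U)
    (hα1 : T.shift α (-1) ∈ T.U) : ∀ x ∈ T.I, T.ψ₀ (T.shift α (-1)) x ≠ 0 := by
  have hs : T.shift (T.shift α (-1)) 1 = α := by rw [shift_shift]; exact shift_zero α
  refine ne_zero_of_dbtPotential_eq hT.isOpen hT.ordConnected (V := T.V (T.shift α (-1)))
    (W := fun x => T.V α x + T.R (T.shift α (-1))) (hT.smooth_ψ₀ _ hα1)
    (hT.smooth_V _ hα1).continuousOn ((hT.smooth_V _ hα).continuousOn.add continuousOn_const)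
    (hT.equation_ψ₀ hα1).toIsFormalEigenfunction fun x hx h0 => ?_
  rw [hT.shapeInvariant _ hα1 (hs.symm ▸ hα) x hx h0, hs]

theorem IsTSIP.ψ₀_neg_ne_zero (hT : T.IsTSIP) (hΓ : T.HasGammaThree) {α : Fin N → ℝ}
    (hα : α ∈ T.U) (hα1 : T.shift α (-1) ∈ T.U) : ∀ x ∈ T.I, T.ψ₀ (-α) x ≠ 0 := by
  have hcont : ∀ β ∈ T.U, ContinuousOn (T.V (-β)) T.I := by
    intro β hβ
    obtain ⟨δ, hδ⟩ := hΓ.covariant β hβ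
    exact ((hT.smooth_V β hβ).continuousOn.add continuousOn_const).congr hδ
  refine ne_zero_of_dbtPotential_eq hT.isOpen hT.ordConnected (V := T.V (-α))
    (W := fun x => T.V (-T.shift α (-1)) x + T.R (-α)) (hΓ.smooth_ψ₀ _ hα)
    (hcont α hα) ((hcont _ hα1).add continuousOn_const) (hΓ.eigenfunction α hα) fun x hx h0 => ?_
  rw [hΓ.shapeInvariant α hα hα1 x hx h0, shift_neg_one]

theorem IsTSIP.dbtPotential_ψ₀ (hT : T.IsTSIP) {α : Fin N → ℝ} (hα : α ∈ T.U)
    (hα1 : T.shift α (-1) ∈ T.U) {x : ℝ} (hx : x ∈ T.I) :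
    dbtPotential (T.V (T.shift α (-1))) (T.ψ₀ (T.shift α (-1))) x
      = T.V α x + T.R (T.shift α (-1)) := by
  have hs : T.shift (T.shift α (-1)) 1 = α := by rw [shift_shift]; exact shift_zero α
  rw [hT.shapeInvariant _ hα1 (hs.symm ▸ hα) x hx (hT.ψ₀_ne_zero hα hα1 x hx), hs]

/-- `w₀(x;-α) = -w₀(x;α₋₁)` and `V(x;-α) = V(x;α) + R(α₋₁)`. -/
theorem IsTSIP.reflected (hT : T.IsTSIP) (hΓ : T.HasGammaThree) {α : Fin N → ℝ}
    (hα : α ∈ T.U) (hα1 : T.shift α (-1) ∈ T.U) :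
    (∀ x ∈ T.I, rsFun (T.ψ₀ (-α)) x = -rsFun (T.ψ₀ (T.shift α (-1))) x) ∧
      ∀ x ∈ T.I, T.V (-α) x = T.V α x + T.R (T.shift α (-1)) := by
  obtain ⟨δ, hδ⟩ := hΓ.covariant α hα
  obtain ⟨δ', hδ'⟩ := hΓ.covariant _ hα1
  have key := rsFun_eq_neg_of_partners hT.isOpen hT.ordConnected hT.nonempty
    (A := T.V α) (B := T.V (T.shift α (-1))) (φ := T.ψ₀ (T.shift α (-1))) (ψ := T.ψ₀ (-α))
    (r := T.R (T.shift α (-1))) (s := δ' + T.R (-α)) (δ := δ)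
    (hT.smooth_ψ₀ _ hα1) (hT.ψ₀_ne_zero hα hα1) (hT.equation_ψ₀ hα1).equation
    (hΓ.smooth_ψ₀ _ hα) (hT.ψ₀_neg_ne_zero hΓ hα hα1)
    (fun x hx => by rw [← hδ x hx]; exact (hΓ.eigenfunction α hα).equation x hx)
    (fun x hx => hT.dbtPotential_ψ₀ hα hα1 hx)
    (fun x hx => by
      rw [← hδ x hx]
      refine (hΓ.shapeInvariant α hα hα1 x hx (hT.ψ₀_neg_ne_zero hΓ hα hα1 x hx)).trans ?_
      rw [shift_neg_one, hδ' x hx, add_assoc])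
    (hT.equation_ψ₀ hα1).dirichlet (hΓ.diverges α hα hα1)
  exact ⟨key.1, fun x hx => by rw [hδ x hx, key.2]⟩

/-! ## The symmetrized states -/

theorem state_natCast_succ (n : ℕ) (α : Fin N → ℝ) :
    T.state ((n : ℤ) + 1) (T.shift α (-1))
      = opAdj (T.ψ₀ (T.shift α (-1))) (T.state n α) := by
  show opAdj (T.ψ₀ (T.shift α (-1))) (T.stateNat n (T.shift (T.shift α (-1)) 1)) = _
  rw [shift_shift, neg_add_cancel, shift_zero]
  rfl

theorem state_neg_one (α : Fin N → ℝ) : T.state (-1) α = T.ψ₀ (-α) := rfl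

theorem state_neg_succ_succ (k : ℕ) (α : Fin N → ℝ) :
    T.state (-((k : ℤ) + 1 + 1)) α
      = opAdj (T.ψ₀ (-α)) (T.state (-((k : ℤ) + 1)) (T.shift α (-1))) := by
  have h1 : -((k : ℤ) + 1 + 1) = Int.negSucc (k + 1) := by rw [Int.negSucc_eq]; push_cast; ring
  have h2 : -((k : ℤ) + 1) = Int.negSucc k := by rw [Int.negSucc_eq]
  rw [h1, h2]
  show opAdj (T.ψ₀ (-α)) (T.stateNat k (T.shift (-α) 1)) = _
  rw [shift_neg_one]
  rfl

theorem IsTSIP.state_neg_succ_succ (hT : T.IsTSIP) (hΓ : T.HasGammaThree) {α : Fin N → ℝ}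
    (hα : α ∈ T.U) (hα1 : T.shift α (-1) ∈ T.U) (k : ℕ) :
    PropOn T.I (T.state (-((k : ℤ) + 1 + 1)) α)
      (opA (T.ψ₀ (T.shift α (-1))) (T.state (-((k : ℤ) + 1)) (T.shift α (-1)))) := by
  rw [PotentialFamily.state_neg_succ_succ]
  exact propOn_opAdj_opA (hT.reflected hΓ hα hα1).1 _

theorem shift_mem_of_le {α : Fin N → ℝ} {m : ℕ}
    (hα : ∀ j : ℕ, j ≤ m → T.shift α (-(j : ℤ)) ∈ T.U) (i : ℕ) {k : ℕ} (hk : i + k ≤ m) :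
    ∀ j : ℕ, j ≤ k → T.shift (T.shift α (-(i : ℤ))) (-(j : ℤ)) ∈ T.U := by
  intro j hj
  rw [shift_shift]
  convert hα (i + j) (by omega) using 2
  push_cast
  ring

/-- `ψ_{-k}(x;α)` is a smooth formal eigenfunction of `V(x;α)` of energy `E_{-k}(α)`. -/
theorem IsTSIP.state_neg (hT : T.IsTSIP) (hΓ : T.HasGammaThree) (k : ℕ) :
    ∀ α : Fin N → ℝ, (∀ j : ℕ, j ≤ k + 1 → T.shift α (-(j : ℤ)) ∈ T.U) →
      ContDiffOn ℝ ∞ (T.state (-((k : ℤ) + 1)) α) T.I ∧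
      IsFormalEigenfunction T.I (T.V α) (T.energy (-((k : ℤ) + 1)) α)
        (T.state (-((k : ℤ) + 1)) α) := by
  induction k with
  | zero =>
    intro α hα
    have h0 : α ∈ T.U := by simpa [shift_zero] using hα 0 (by omega)
    have h1 : T.shift α (-1) ∈ T.U := by simpa using hα 1 le_rfl
    have hE : T.energy (-(((0 : ℕ) : ℤ) + 1)) α = 0 + -T.R (T.shift α (-1)) := by
      rw [energy_neg_succ']
      simp [energy, energyNat]
    rw [hE]
    exact ⟨hΓ.smooth_ψ₀ α h0, (hΓ.eigenfunction α h0).of_propOn hT.isOpen (PropOn.refl _ _)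
      fun x hx => by rw [(hT.reflected hΓ h0 h1).2 x hx]; ring⟩
  | succ k ih =>
    intro α hα
    have h0 : α ∈ T.U := by simpa [shift_zero] using hα 0 (by omega)
    have h1 : T.shift α (-1) ∈ T.U := by simpa using hα 1 (by omega)
    have hβ : ∀ j : ℕ, j ≤ k + 1 → T.shift (T.shift α (-1)) (-(j : ℤ)) ∈ T.U :=
      shift_mem_of_le hα 1 (by omega)
    obtain ⟨hs, hE⟩ := ih _ hβ
    have hneg := hT.energy_neg hβ
    set β := T.shift α (-1)
    set f := T.state (-((k : ℤ) + 1)) β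
    set e := T.energy (-((k : ℤ) + 1)) β
    have hφ := hT.smooth_ψ₀ β h1
    have hφ0 := hT.ψ₀_ne_zero h0 h1
    have hφE := (hT.equation_ψ₀ h1).equation
    have hsm := contDiffOn_opA hT.isOpen hφ hφ0 hs
    have hp := hT.state_neg_succ_succ hΓ h0 h1 k
    have hA : IsFormalEigenfunction T.I (dbtPotential (T.V β) (T.ψ₀ β)) e (opA (T.ψ₀ β) f) := by
      refine ⟨hsm.of_le ENat.LEInfty.out,
        fun x hx => equation_opA hT.isOpen hφ hφ0 hφE hs hE.equation hx, ?_⟩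
      -- The image cannot vanish identically: `A⁺` would send it to `0`, whereas `A⁺A f = e f` with
      -- `e < 0`.
      by_contra! hz
      obtain ⟨x, hx, hx0⟩ := hE.nontrivial
      have h2 := opAdj_opA hT.isOpen hφ hφ0 hφE hs hE.equation hx
      have h3 : deriv (opA (T.ψ₀ β) f) x = 0 := by
        rw [deriv_eqOn_of_eqOn hT.isOpen
          (show Set.EqOn (opA (T.ψ₀ β) f) (fun _ => (0 : ℝ)) T.I from hz) hx]
        simp
      rw [opAdj, h3, hz x hx, neg_zero, mul_zero, add_zero] at h2
      exact mul_ne_zero hneg.ne hx0 h2.symm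
    have hen : T.energy (-(((k + 1 : ℕ) : ℤ) + 1)) α = e + -T.R β := by
      rw [energy_neg_succ']
      push_cast
      ring
    rw [hen]
    push_cast
    refine ⟨?_, hA.of_propOn hT.isOpen hp fun x hx => ?_⟩
    · obtain ⟨c, -, hc⟩ := hp
      exact (contDiffOn_const.mul hsm).congr hc
    · rw [hT.dbtPotential_ψ₀ h0 h1 hx]
      ring

/-! ## The chain -/

/-- The DBT with seed `ψ₋₁(x;α)` maps `ψ_l(x;α)` to a multiple of `ψ_{l+1}(x;α₋₁)`. -/
theorem IsTSIP.dbtFamily_neg_one (hT : T.IsTSIP) (hΓ : T.HasGammaThree) {α : Fin N → ℝ} {m : ℕ}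
    (hα : ∀ j : ℕ, j ≤ m + 1 → T.shift α (-(j : ℤ)) ∈ T.U) {l : ℤ} (hl : -((m : ℤ) + 1) ≤ l) :
    PropOn T.I (dbtFamily (-1) (fun l => T.state l α) l) (T.state (l + 1) (T.shift α (-1))) := by
  have h0 : α ∈ T.U := by simpa [shift_zero] using hα 0 (by omega)
  have h1 : T.shift α (-1) ∈ T.U := by simpa using hα 1 (by omega)
  have hw := (hT.reflected hΓ h0 h1).1
  have hφ0 := hT.ψ₀_ne_zero h0 h1
  rw [dbtFamily]
  split_ifs with h
  · subst h
    exact propOn_one_div_of_rsFun_eq_neg hT.isOpen hT.ordConnected hT.nonempty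
      (hT.smooth_ψ₀ _ h1) hφ0 (hΓ.smooth_ψ₀ α h0) (hT.ψ₀_neg_ne_zero hΓ h0 h1) hw
  · show PropOn T.I (opA (T.ψ₀ (-α)) (T.state l α)) _
    refine (propOn_opA_opAdj hw _).trans ?_
    rcases le_or_gt 0 l with hl0 | hl0
    · lift l to ℕ using hl0
      rw [state_natCast_succ]
      exact PropOn.refl _ _
    · obtain ⟨k, rfl⟩ : ∃ k : ℕ, l = -((k : ℤ) + 1 + 1) :=
        ⟨(-l - 2).toNat, by omega⟩
      have hβ : ∀ j : ℕ, j ≤ k + 1 → T.shift (T.shift α (-1)) (-(j : ℤ)) ∈ T.U :=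
        shift_mem_of_le hα 1 (by omega)
      obtain ⟨hs, hE⟩ := hT.state_neg hΓ k _ hβ
      refine ((hT.state_neg_succ_succ hΓ h0 h1 k).opAdj hT.isOpen _).trans ?_
      rw [show -((k : ℤ) + 1 + 1) + 1 = -((k : ℤ) + 1) by ring]
      exact ⟨_, (hT.energy_neg hβ).ne, fun x hx => opAdj_opA hT.isOpen (hT.smooth_ψ₀ _ h1) hφ0
        (hT.equation_ψ₀ h1).equation hs hE.equation hx⟩

/-- After `j` steps of the chain, `ψ_l(x;α)` has become a multiple of `ψ_{l+j}(x;α₋ⱼ)`. -/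
theorem IsTSIP.extState_propOn (hT : T.IsTSIP) (hΓ : T.HasGammaThree) {α : Fin N → ℝ} {m : ℕ}
    (hα : ∀ j : ℕ, j ≤ m → T.shift α (-(j : ℤ)) ∈ T.U) {j : ℕ} (hj : j ≤ m) :
    ∀ l : ℤ, -(m : ℤ) ≤ l →
      PropOn T.I (T.extState j l α) (T.state (l + j) (T.shift α (-(j : ℤ)))) := by
  induction j with
  | zero =>
    intro l _
    simp only [Nat.cast_zero, neg_zero, add_zero, shift_zero]
    exact PropOn.refl _ _
  | succ j ih =>
    intro l hl
    have ih := ih (by omega)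
    -- From `α₋ⱼ` the parameter can still go down `k + 1` times inside `U`, which covers every index
    -- `l + j ≥ -(k + 1)`.
    obtain ⟨k, rfl⟩ : ∃ k, m = j + (k + 1) := ⟨m - j - 1, by omega⟩
    have hβ := shift_mem_of_le hα j (k := k + 1) le_rfl
    push_cast at hl
    have hseed := ih (addingIndex j) (by rw [addingIndex]; push_cast; omega)
    rw [show addingIndex j + (j : ℤ) = -1 by rw [addingIndex]; ring] at hseed
    have h1 := dbtFamily_propOn hT.isOpen (ν := addingIndex j) (μ := -1) (l := l) (k := l + j)
      (ψ := fun l => T.extState j l α) (χ := fun l => T.state l (T.shift α (-(j : ℤ))))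
      hseed (ih l (by push_cast; omega)) (by rw [addingIndex]; omega)
    have h2 := hT.dbtFamily_neg_one hΓ hβ (l := l + j) (by omega)
    have h3 := h1.trans h2
    rw [shift_shift, add_assoc] at h3
    push_cast
    rw [neg_add]
    exact h3

theorem IsTSIP.seed_propOn (hT : T.IsTSIP) (hΓ : T.HasGammaThree) {α : Fin N → ℝ} {m : ℕ}
    (hα : ∀ j : ℕ, j ≤ m → T.shift α (-(j : ℤ)) ∈ T.U) {j : ℕ} (hj : j < m) :
    PropOn T.I (T.extState j (-((j : ℤ) + 1)) α) (T.ψ₀ (-T.shift α (-(j : ℤ)))) := by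
  have h := hT.extState_propOn hΓ hα hj.le (-((j : ℤ) + 1)) (by omega)
  rwa [show -((j : ℤ) + 1) + j = -1 by ring, state_neg_one] at h

theorem IsTSIP.extPotential_eq (hT : T.IsTSIP) (hΓ : T.HasGammaThree) {α : Fin N → ℝ} {m : ℕ}
    (hα : ∀ j : ℕ, j ≤ m → T.shift α (-(j : ℤ)) ∈ T.U) {j : ℕ} (hj : j ≤ m) :
    ∀ x ∈ T.I, T.extPotential j α x
      = T.V (T.shift α (-(j : ℤ))) x + T.energy (-(j : ℤ)) α := by
  induction j with
  | zero =>
    intro x _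
    simp [shift_zero, extPotential, chainPotential, energy, energyNat]
  | succ j ih =>
    intro x hx
    have ih := ih (by omega) x hx
    have hw := shift_mem_of_le hα j (k := 1) hj
    set β := T.shift α (-(j : ℤ)) with hβdef
    have h0 : β ∈ T.U := by simpa [shift_zero] using hw 0 (by omega)
    have h1 : T.shift β (-1) ∈ T.U := by simpa using hw 1 le_rfl
    have hsh : T.shift α (-((j : ℤ) + 1)) = T.shift β (-1) := by
      rw [hβdef, shift_shift, neg_add]
    have hd : deriv (rsFun (T.ψ₀ (-β))) x = -deriv (rsFun (T.ψ₀ (T.shift β (-1)))) x := by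
      rw [deriv_eqOn_of_eqOn hT.isOpen (show Set.EqOn _ (fun x => -rsFun (T.ψ₀ (T.shift β (-1))) x)
        T.I from (hT.reflected hΓ h0 h1).1) hx]
      exact deriv.fun_neg
    have hp := hT.dbtPotential_ψ₀ h0 h1 hx
    have hstep : T.extPotential (j + 1) α x
        = T.extPotential j α x + 2 * deriv (rsFun (T.ψ₀ (-β))) x :=
      (hT.seed_propOn hΓ hα (by omega : j < m)).dbtPotential_eq hT.isOpen hx
    push_cast
    rw [hstep, ih, hd, energy_neg_succ, hsh]
    rw [dbtPotential] at hp
    linarith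

/-- The DBT with seed `ψ₋₁(α)` turns the remaining seeds into multiples of the seeds `ψ₋₁, …, ψ₋ₘ`
at `α₋₁`, so Crum's reduction gives an induction on `m`. -/
theorem IsTSIP.wronskianFun_ne_zero (hT : T.IsTSIP) (hΓ : T.HasGammaThree) (m : ℕ) :
    ∀ α : Fin N → ℝ, (∀ j : ℕ, j ≤ m → T.shift α (-(j : ℤ)) ∈ T.U) →
      ∀ x ∈ T.I, wronskianFun (fun i : Fin m => T.state (-((i : ℤ) + 1)) α) x ≠ 0 := by
  induction m with
  | zero => intro α _ x _; simp [wronskianFun]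
  | succ m ih =>
    intro α hα x hx
    have h0 : α ∈ T.U := by simpa [shift_zero] using hα 0 (by omega)
    have h1 : T.shift α (-1) ∈ T.U := by simpa using hα 1 (by omega)
    refine wronskianFun_ne_zero_of_opA hT.isOpen
      (z := fun i : Fin m => T.state (-((i : ℤ) + 1)) (T.shift α (-1)))
      (fun i => (hT.state_neg hΓ i α fun j hj => hα j (by omega)).1)
      (hT.ψ₀_neg_ne_zero hΓ h0 h1) (fun i => ?_) hx
      (ih _ (shift_mem_of_le hα 1 (by omega)) x hx)
    have := hT.dbtFamily_neg_one hΓ hα (l := -((i : ℤ) + 1 + 1)) (by omega)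
    rw [dbtFamily, if_neg (by omega), show -((i : ℤ) + 1 + 1) + 1 = -((i : ℤ) + 1) by ring] at this
    simpa using this

theorem levels_shift_neg {α : Fin N → ℝ} {m : ℕ}
    (hα : ∀ j : ℕ, j ≤ m → T.shift α (-(j : ℤ)) ∈ T.U) :
    T.levels (T.shift α (-(m : ℤ))) = {j : ℕ | j < m ∨ ∃ n ∈ T.levels α, j = n + m} := by
  have hlow : ∀ i : ℕ, i ≤ m → T.shift α (-(m : ℤ) + i) ∈ T.U := by
    intro i hi
    convert hα (m - i) (by omega) using 2
    push_cast [Nat.cast_sub hi]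
    ring
  ext j
  simp only [levels, Set.mem_ofPred_eq, shift_shift]
  constructor
  · intro h
    rcases lt_or_ge j m with hj | hj
    · exact Or.inl hj
    · refine Or.inr ⟨j - m, fun k hk => ?_, by omega⟩
      convert h (m + k) (by omega) using 2
      push_cast
      ring
  · rintro (hj | ⟨n, hn, rfl⟩) k hk
    · exact hlow k (by omega)
    · rcases le_total k m with hkm | hkm
      · exact hlow k hkm
      · convert hn (k - m) (by omega) using 2
        push_cast [Nat.cast_sub hkm]
        ring

end PotentialFamily


theorem lemma4 {N : ℕ} (T : PotentialFamily N) (hT : T.IsTSIP) (hΓ : T.HasGammaThree)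
    (m : ℕ) (α : Fin N → ℝ) (hα : ∀ j : ℕ, j ≤ m → T.shift α (-(j : ℤ)) ∈ T.U) :
    -- the seeds are eigenfunctions of `V(x;α)` for the energies `E_{-k}(α)`
    (∀ k : ℕ, 1 ≤ k → k ≤ m →
      IsFormalEigenfunction T.I (T.V α) (T.energy (-(k : ℤ)) α) (T.state (-(k : ℤ)) α)) ∧
    -- every step of the chain, and the final potential, are regular
    (∀ j : ℕ, j < m → ∀ x ∈ T.I, T.extState j (-((j : ℤ) + 1)) α x ≠ 0) ∧
    ContDiffOn ℝ ∞ (T.extPotential m α) T.I ∧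
    -- reverse shape invariance
    (∀ x ∈ T.I, T.extPotential m α x
      = T.V (T.shift α (-(m : ℤ))) x + T.energy (-(m : ℤ)) α) ∧
    -- the spectrum: `m` new levels below those of `V(x;α)`
    IsDirichletSpectrum T.I (T.extPotential m α)
      {j : ℕ | j < m ∨ ∃ n ∈ T.levels α, j = n + m}
      (fun j => T.energy ((j : ℤ) - m) α) (fun j => T.extState m ((j : ℤ) - m) α) ∧
    -- the eigenstates
    (∀ j : ℕ, PropOn T.I (T.extState m ((j : ℤ) - m) α)
      (T.state (j : ℤ) (T.shift α (-(m : ℤ))))) ∧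
    -- the Wronskian of the seeds is nodeless
    (∀ x ∈ T.I, wronskianFun (fun i : Fin m => T.state (-((i : ℤ) + 1)) α) x ≠ 0) := by
  have hI := hT.isOpen
  have hU : T.shift α (-(m : ℤ)) ∈ T.U := hα m le_rfl
  have hV := hT.extPotential_eq hΓ hα le_rfl
  have hstates : ∀ j : ℕ, PropOn T.I (T.extState m ((j : ℤ) - m) α)
      (T.state (j : ℤ) (T.shift α (-(m : ℤ)))) := by
    intro j
    have h := hT.extState_propOn hΓ hα le_rfl ((j : ℤ) - m) (by omega)
    rwa [sub_add_cancel] at h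
  refine ⟨fun k hk1 hkm => ?_, fun j hj x hx => ?_, ?_, hV, ?_, hstates,
    hT.wronskianFun_ne_zero hΓ m α hα⟩
  · obtain ⟨k, rfl⟩ := Nat.exists_eq_add_of_le' hk1
    have := (hT.state_neg hΓ k α fun j hj => hα j (by omega)).2
    push_cast
    exact this
  · have hw := PotentialFamily.shift_mem_of_le hα j (k := 1) hj
    exact (hT.seed_propOn hΓ hα hj).ne_zero hx (hT.ψ₀_neg_ne_zero hΓ
      (by simpa [PotentialFamily.shift_zero] using hw 0 (by omega)) (by simpa using hw 1 le_rfl) x hx)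
  · exact ((hT.smooth_V _ hU).add contDiffOn_const).congr hV
  -- The spectrum at `α₋ₘ`, completeness included, is carried over by the energy shift and the
  -- proportionality of the states.
  · rw [← PotentialFamily.levels_shift_neg hα]
    exact (hT.spectrum _ hU).of_propOn hI hV (fun j => PotentialFamily.energy_sub j m α) hstates
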